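/- Let $X$ be a set and let $\mathcal M$ be a set of partial transformations of $X$, that is, maps $\omega\colon D_\omega\to X$ with $D_\omega\subseteq X$ (total maps $X\to X$ being a special case), which contains the identity map and is closed under composition. An order pair is a pair $\langle W,S\rangle$ of binary relations on $X$ with $S\subseteq W$. The data are an order pair $\langle\succsim^R,\succ^R\rangle$ with $\succsim^R$ reflexive. An $\mathcal M$-invariant rationalization of the data is a complete and transitive relation $\succeq$ on $X$, with asymmetric part $\succ$, such that $\succsim^R\subseteq\succeq$, $\succ^R\subseteq\succ$, and, for all $\omega\in\mathcal M$ and $x,y\in D_\omega$, $x\succeq y\iff\omega(x)\succeq\omega(y)$. Write $x\succsim^R_\intercal y$ if there is a finite chain $x=x_0\succsim^R x_1\succsim^R\cdots\succsim^R x_N=y$, and $x\succ^R_\intercal y$ if there is such a chain with at least one link in $\succ^R$. A broken cycle consists of $N\ge1$, $\omega_1,\dots,\omega_N\in\mathcal M$ and $x_i,y_i\in D_{\omega_i}$ $(1\le i\le N)$ such that $\omega_i(x_i)\succsim^R_\intercal\omega_{i+1}(y_{i+1})$ for all $i$ (indices cyclic modulo $N$); it is strict if $\omega_i(x_i)\succ^R_\intercal\omega_{i+1}(y_{i+1})$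 for some $i$. An order pair $\langle W,S\rangle$ is a forbidden subrelation for it if $W=\{(y_i,x_i):1\le i\le N\}$ and, in case the broken cycle is not strict, $S\ne\varnothing$. An order pair $\langle\tilde W,\tilde S\rangle$ is a collapse of $\langle W_1,S_1\rangle$ and $\langle W_2,S_2\rangle$ if, for some $\{i,j\}=\{1,2\}$, $\omega,\omega'\in\mathcal M$ and $x,y\in D_\omega\cap D_{\omega'}$, one has $p=(\omega(x),\omega(y))\in W_i\setminus S_i$, $q=(\omega'(y),\omega'(x))\in W_j$, $\tilde W=(W_i\setminus\{p\})\cup(W_j\setminus\{q\})$ and $\tilde S=S_i\cup(S_j\setminus\{q\})$. Let $\mathcal F^0$ be the set of all forbidden subrelations of broken cycles, let $\mathcal F^{n}$ consist of the elements of $\mathcal F^{n-1}$ and all collapses of two of them, and let the collapse closure be $\mathcal F^*=\bigcup_{n\ge0}\mathcal F^n$. The data are strongly acyclic if $\langle\varnothing,\varnothing\rangle\notin\mathcal F^*$. **Theorem.** Suppose the data $\langle\succsim^R,\succ^R\rangle$ are strongly acyclic, and let $x,y\in X$. Then $x\succeq^* y$ for every $\mathcal M$-invariant rationalization $\succeq^*$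 if and only if $\langle\{(y,x)\},\{(y,x)\}\rangle\in\mathcal F^*$; and $x\succ^* y$ for every $\mathcal M$-invariant rationalization $\succeq^*$ if and only if $\langle\{(y,x)\},\varnothing\rangle\in\mathcal F^*$. -/

import Mathlib

/-- An order pair `⟨W, S⟩` on `X`: two binary relations (sets of pairs) with `S ⊆ W`. -/
@[ext]
structure OrderPair (X : Type*) where
  weak : Set (X × X)
  strict : Set (X × X)
  strict_subset : strict ⊆ weak

namespace OrderPair

variable {X : Type*}

/-- The empty order pair `⟨∅, ∅⟩`. -/
def empty (X : Type*) : OrderPair X := ⟨∅, ∅, Set.Subset.rfl⟩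

/-- Weak part of the transitive closure: a finite chain of weak relations from `x` to `y`. -/
def TransWeak (D : OrderPair X) (x y : X) : Prop :=
  Relation.ReflTransGen (fun u v => (u, v) ∈ D.weak) x y

/-- Strict part of the transitive closure: a finite chain of weak relations from `x` to `y`,
one of whose links is strict. -/
def TransStrict (D : OrderPair X) (x y : X) : Prop :=
  ∃ u v, D.TransWeak x u ∧ (u, v) ∈ D.strict ∧ D.TransWeak v y

end OrderPair

section

variable {X : Type*}

/-- A preference relation: complete and transitive. -/
structure IsPreference (R : X → X → Prop) : Prop where
  complete : ∀ x y, R x y ∨ R y x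
  trans : ∀ x y z, R x y → R y z → R x z

/-- The asymmetric component of a relation. -/
def StrictPart (R : X → X → Prop) (x y : X) : Prop := R x y ∧ ¬ R y x

/-- Invariance of a relation under every partial transformation in `M`; here `a ∈ ω x` says that
`ω` is defined at `x` with value `a`. -/
def IsInvariantUnder (M : Set (X →. X)) (R : X → X → Prop) : Prop :=
  ∀ ω ∈ M, ∀ x y a b : X, a ∈ ω x → b ∈ ω y → (R x y ↔ R a b)

/-- `R` is an `M`-invariant preference relation that rationalizes the data `D`. -/
structure IsRationalization (M : Set (X →. X)) (D : OrderPair X) (R : X → X → Prop) : Prop where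
  preference : IsPreference R
  invariant : IsInvariantUnder M R
  weak_le : ∀ x y, (x, y) ∈ D.weak → R x y
  strict_le : ∀ x y, (x, y) ∈ D.strict → StrictPart R x y

/-- A broken cycle with `n + 1` gaps. Here `a i` is the value `ω i (x i)`, `b i` is the value
`ω i (y i)`, and the index `i + 1` in `Fin (n + 1)` is cyclic. -/
structure BrokenCycle (M : Set (X →. X)) (D : OrderPair X) where
  n : ℕ
  ω : Fin (n + 1) → (X →. X)
  ω_mem : ∀ i, ω i ∈ M
  x : Fin (n + 1) → X
  y : Fin (n + 1) → X
  a : Fin (n + 1) → X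
  b : Fin (n + 1) → X
  map_x : ∀ i, a i ∈ ω i (x i)
  map_y : ∀ i, b i ∈ ω i (y i)
  rel : ∀ i, D.TransWeak (a i) (b (i + 1))

/-- One of the links of the broken cycle is strict. -/
def BrokenCycle.IsStrict {M : Set (X →. X)} {D : OrderPair X} (c : BrokenCycle M D) : Prop :=
  ∃ i, D.TransStrict (c.a i) (c.b (i + 1))

/-- `P = ⟨W, S⟩` is a forbidden subrelation for the broken cycle `c`: `W` is the set of all the
pairs `(y i, x i)`, and `S ⊆ W` is non-empty unless `c` is strict. -/
def BrokenCycle.IsForbidden {M : Set (X →. X)} {D : OrderPair X} (c : BrokenCycle M D)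
    (P : OrderPair X) : Prop :=
  P.weak = Set.range (fun i => (c.y i, c.x i)) ∧ (¬ c.IsStrict → P.strict.Nonempty)

/-- `E` arises from `A` and `B` by deleting `(ω x, ω y)`, a pair of `A` that is not strict, and
`(ω' y, ω' x)`, a pair of `B`, and taking unions. Here `a = ω x`, `b = ω y`, `a' = ω' x` and
`b' = ω' y`. -/
def IsDirectedCollapse (M : Set (X →. X)) (A B E : OrderPair X) : Prop :=
  ∃ ω ∈ M, ∃ ω' ∈ M, ∃ x y a b a' b' : X,
    a ∈ ω x ∧ b ∈ ω y ∧ a' ∈ ω' x ∧ b' ∈ ω' y ∧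
    (a, b) ∈ A.weak \ A.strict ∧ (b', a') ∈ B.weak ∧
    E.weak = (A.weak \ {(a, b)}) ∪ (B.weak \ {(b', a')}) ∧
    E.strict = A.strict ∪ (B.strict \ {(b', a')})

/-- `E` is a collapse of the two order pairs `A` and `B`, in either of the two roles. -/
def IsCollapse (M : Set (X →. X)) (A B E : OrderPair X) : Prop :=
  IsDirectedCollapse M A B E ∨ IsDirectedCollapse M B A E

/-- The sets `F 0 ⊆ F 1 ⊆ ⋯`: `F 0` consists of the forbidden subrelations of the broken cycles
of the data, and `F (n + 1)` adds all the collapses of two members of `F n`. All members are pairs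
of finite relations. -/
def collapseLevel (M : Set (X →. X)) (D : OrderPair X) : ℕ → Set (OrderPair X)
  | 0 => {P | ∃ c : BrokenCycle M D, c.IsForbidden P}
  | n + 1 => {E | ∃ A ∈ collapseLevel M D n, ∃ B ∈ collapseLevel M D n, IsCollapse M A B E} ∪
      collapseLevel M D n

/-- The collapse closure `F*`. -/
def collapseClosure (M : Set (X →. X)) (D : OrderPair X) : Set (OrderPair X) :=
  ⋃ n, collapseLevel M D n

/-- The data are strongly acyclic: the empty order pair is not in the collapse closure. -/
def StronglyAcyclic (M : Set (X →. X)) (D : OrderPair X) : Prop :=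
  OrderPair.empty X ∉ collapseClosure M D

end

namespace OrderPair

variable {X : Type*}

/-! A collapse is a resolution rule, and the theorem is its soundness and completeness. Soundness: a
rationalization extends no member of the closure (`not_extends_of_mem_collapseClosure`), so a
forbidden singleton `(y, x)` yields the claimed ranking of `x` and `y`. Completeness: by Zorn, an
order pair containing no member of the closure lies in a maximal such pair `Q`. Maximality and
collapses decide every pair in `Q`; broken cycles with one, two or three gaps then make its weak
part a rationalization. If a singleton is not forbidden, strong acyclicity makes it consistent,
hence it extends to a counterexample. -/

instance : PartialOrder (OrderPair X) :=
  PartialOrder.lift (fun P => (P.weak, P.strict)) fun _ _ h =>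
    OrderPair.ext (congrArg Prod.fst h) (congrArg Prod.snd h)

theorem le_def {P Q : OrderPair X} : P ≤ Q ↔ P.weak ⊆ Q.weak ∧ P.strict ⊆ Q.strict := Iff.rfl

end OrderPair

section

variable {X : Type*} {M : Set (X →. X)} {D : OrderPair X}

/-- `R` extends `P` if it contains the weak part of `P` and its asymmetric part contains the
strict part of `P`. -/
def Extends (R : X → X → Prop) (P : OrderPair X) : Prop :=
  (∀ p ∈ P.weak, R p.1 p.2) ∧ ∀ p ∈ P.strict, StrictPart R p.1 p.2

/-! ### Soundness of the collapse closure -/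

theorem IsPreference.refl {R : X → X → Prop} (h : IsPreference R) (x : X) : R x x :=
  (h.complete x x).elim id id

theorem IsRationalization.of_transWeak {R : X → X → Prop} (h : IsRationalization M D R) {x y : X}
    (hxy : D.TransWeak x y) : R x y := by
  induction hxy with
  | refl => exact h.preference.refl x
  | tail _ h2 ih => exact h.preference.trans _ _ _ ih (h.weak_le _ _ h2)

theorem IsRationalization.of_transStrict {R : X → X → Prop} (h : IsRationalization M D R) {x y : X}
    (hxy : D.TransStrict x y) : ¬ R y x := by
  obtain ⟨u, v, h1, h2, h3⟩ := hxy
  intro hyx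
  exact (h.strict_le _ _ h2).2 (h.preference.trans _ _ _ (h.of_transWeak h3)
    (h.preference.trans _ _ _ hyx (h.of_transWeak h1)))

theorem IsPreference.of_cyclic {R : X → X → Prop} (h : IsPreference R) {n : ℕ}
    {f : Fin (n + 1) → X} (hf : ∀ i, R (f i) (f (i + 1))) (i j : Fin (n + 1)) : R (f i) (f j) := by
  have h0 : ∀ j, R (f 0) (f j) := fun j => by
    induction j using Fin.induction with
    | zero => exact h.refl _
    | succ i ih => exact h.trans _ _ _ ih (Fin.coeSucc_eq_succ (a := i) ▸ hf i.castSucc)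
  have h1 : ∀ j, R (f j) (f 0) := fun j => by
    induction j using Fin.reverseInduction with
    | last => exact Fin.last_add_one n ▸ hf (Fin.last n)
    | cast i ih => exact h.trans _ _ _ (Fin.coeSucc_eq_succ (a := i) ▸ hf i.castSucc) ih
  exact h.trans _ _ _ (h1 i) (h0 j)

/-- Invariance carries the pairs `(y i, x i)` to `(b i, a i)`, which close the gaps into a cycle of
`R`; a cycle of a preference has no strict step. -/
theorem BrokenCycle.IsForbidden.not_extends {c : BrokenCycle M D} {P : OrderPair X}
    (hP : c.IsForbidden P) {R : X → X → Prop} (h : IsRationalization M D R) : ¬ Extends R P := by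
  rintro ⟨hw, hs⟩
  have hba : ∀ i, R (c.b i) (c.a i) := fun i =>
    (h.invariant _ (c.ω_mem i) _ _ _ _ (c.map_y i) (c.map_x i)).1
      (hw (c.y i, c.x i) (hP.1 ▸ ⟨i, rfl⟩))
  have hcyc := h.preference.of_cyclic (f := c.b) fun i =>
    h.preference.trans _ _ _ (hba i) (h.of_transWeak (c.rel i))
  by_cases hc : c.IsStrict
  · obtain ⟨i, hi⟩ := hc
    exact h.of_transStrict hi (h.preference.trans _ _ _ (hcyc _ _) (hba i))
  · obtain ⟨p, hp⟩ := hP.2 hc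
    obtain ⟨i, rfl⟩ : p ∈ Set.range fun i => (c.y i, c.x i) := hP.1 ▸ P.strict_subset hp
    refine (hs _ hp).2
      ((h.invariant _ (c.ω_mem i) _ _ _ _ (c.map_x i) (c.map_y i)).2 ?_)
    exact h.preference.trans _ _ _ (h.of_transWeak (c.rel i)) (hcyc _ _)

/-- Either `R x y`, which restores the pair deleted from `A`, or `y` is strictly above `x`, which
restores the one deleted from `B`, strict or not. -/
theorem IsDirectedCollapse.not_extends {A B E : OrderPair X} (hE : IsDirectedCollapse M A B E)
    {R : X → X → Prop} (h : IsRationalization M D R) (hA : ¬ Extends R A) (hB : ¬ Extends R B) :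
    ¬ Extends R E := by
  obtain ⟨ω, hω, ω', hω', x, y, a, b, a', b', ha, hb, ha', hb', -, -, hw, hs⟩ := hE
  rintro ⟨hEw, hEs⟩
  rw [hw] at hEw
  rw [hs] at hEs
  by_cases hxy : R x y
  · refine hA ⟨fun p hp => ?_, fun p hp => hEs p (Or.inl hp)⟩
    by_cases hpe : p = (a, b)
    · subst hpe
      exact (h.invariant ω hω _ _ _ _ ha hb).1 hxy
    · exact hEw p (Or.inl ⟨hp, hpe⟩)
  · have hs' : StrictPart R b' a' :=
      ⟨(h.invariant ω' hω' _ _ _ _ hb' ha').1 ((h.preference.complete x y).resolve_left hxy),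
        fun hab => hxy ((h.invariant ω' hω' _ _ _ _ ha' hb').2 hab)⟩
    refine hB ⟨fun p hp => ?_, fun p hp => ?_⟩ <;> by_cases hpe : p = (b', a')
    · subst hpe
      exact hs'.1
    · exact hEw p (Or.inr ⟨hp, hpe⟩)
    · subst hpe
      exact hs'
    · exact hEs p (Or.inr ⟨hp, hpe⟩)

/-- No rationalization extends a member of the collapse closure. -/
theorem not_extends_of_mem_collapseClosure {P : OrderPair X} (hP : P ∈ collapseClosure M D)
    {R : X → X → Prop} (h : IsRationalization M D R) : ¬ Extends R P := by
  obtain ⟨n, hn⟩ := Set.mem_iUnion.1 hP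
  clear hP
  induction n generalizing P with
  | zero =>
    obtain ⟨c, hc⟩ := hn
    exact hc.not_extends h
  | succ n ih =>
    rcases hn with ⟨A, hA, B, hB, hE | hE⟩ | hn
    · exact hE.not_extends h (ih hA) (ih hB)
    · exact hE.not_extends h (ih hB) (ih hA)
    · exact ih hn

theorem IsDirectedCollapse.finite {A B E : OrderPair X} (hE : IsDirectedCollapse M A B E)
    (hA : A.weak.Finite) (hB : B.weak.Finite) : E.weak.Finite := by
  obtain ⟨_, _, _, _, _, _, _, _, _, _, _, _, _, _, _, _, hw, _⟩ := hE
  rw [hw]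
  exact hA.sdiff.union hB.sdiff

theorem finite_of_mem_collapseClosure {P : OrderPair X} (hP : P ∈ collapseClosure M D) :
    P.weak.Finite := by
  obtain ⟨n, hn⟩ := Set.mem_iUnion.1 hP
  clear hP
  induction n generalizing P with
  | zero =>
    obtain ⟨c, hc⟩ := hn
    rw [hc.1]
    exact Set.finite_range _
  | succ n ih =>
    rcases hn with ⟨A, hA, B, hB, hE | hE⟩ | hn
    · exact hE.finite (ih hA) (ih hB)
    · exact hE.finite (ih hB) (ih hA)
    · exact ih hn

theorem collapseLevel_mono : Monotone (collapseLevel M D) :=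
  monotone_nat_of_le_succ fun _ _ h => Or.inr h

theorem BrokenCycle.IsForbidden.mem_collapseClosure {c : BrokenCycle M D} {P : OrderPair X}
    (hP : c.IsForbidden P) : P ∈ collapseClosure M D :=
  Set.mem_iUnion.2 ⟨0, c, hP⟩

/-- The collapse closure is closed under collapses at a pair and its reverse. -/
theorem exists_collapse_mem (hid : PFun.id X ∈ M) {A B : OrderPair X}
    (hA : A ∈ collapseClosure M D) (hB : B ∈ collapseClosure M D) {x y : X}
    (hp : (x, y) ∈ A.weak \ A.strict) (hq : (y, x) ∈ B.weak) :
    ∃ E ∈ collapseClosure M D, E.weak = (A.weak \ {(x, y)}) ∪ (B.weak \ {(y, x)}) ∧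
      E.strict = A.strict ∪ (B.strict \ {(y, x)}) := by
  obtain ⟨n, hn⟩ := Set.mem_iUnion.1 hA
  obtain ⟨m, hm⟩ := Set.mem_iUnion.1 hB
  refine ⟨⟨(A.weak \ {(x, y)}) ∪ (B.weak \ {(y, x)}), A.strict ∪ (B.strict \ {(y, x)}), ?_⟩,
    Set.mem_iUnion.2 ⟨max n m + 1, Or.inl ⟨A, collapseLevel_mono (le_max_left _ _) hn, B,
      collapseLevel_mono (le_max_right _ _) hm, Or.inl ?_⟩⟩, rfl, rfl⟩
  · refine Set.union_subset_union (fun p hpA => ⟨A.strict_subset hpA, ?_⟩)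
      (Set.sdiff_subset_sdiff_left B.strict_subset)
    rintro rfl
    exact hp.2 hpA
  · exact ⟨_, hid, _, hid, x, y, x, y, x, y, Part.mem_some _, Part.mem_some _, Part.mem_some _,
      Part.mem_some _, hp, hq, rfl, rfl⟩

/-! ### Axioms of a rationalization as short broken cycles -/

theorem mem_collapseClosure_of_transWeak (hid : PFun.id X ∈ M) {x y : X} (h : D.TransWeak x y)
    {P : OrderPair X} (hw : P.weak = {(y, x)}) (hs : P.strict.Nonempty) :
    P ∈ collapseClosure M D := by
  let c : BrokenCycle M D :=
    { n := 0, ω := fun _ => PFun.id X, ω_mem := fun _ => hid, x := fun _ => x, y := fun _ => y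
      a := fun _ => x, b := fun _ => y, map_x := fun _ => Part.mem_some _
      map_y := fun _ => Part.mem_some _, rel := fun _ => h }
  exact BrokenCycle.IsForbidden.mem_collapseClosure (c := c)
    ⟨hw.trans Set.range_const.symm, fun _ => hs⟩

theorem mem_collapseClosure_of_transStrict (hid : PFun.id X ∈ M) {x y : X}
    (h : D.TransStrict x y) {P : OrderPair X} (hw : P.weak = {(y, x)}) :
    P ∈ collapseClosure M D := by
  have h' : D.TransWeak x y := by
    obtain ⟨u, v, h1, h2, h3⟩ := h
    exact h1.trans (Relation.ReflTransGen.head (D.strict_subset h2) h3)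
  let c : BrokenCycle M D :=
    { n := 0, ω := fun _ => PFun.id X, ω_mem := fun _ => hid, x := fun _ => x, y := fun _ => y
      a := fun _ => x, b := fun _ => y, map_x := fun _ => Part.mem_some _
      map_y := fun _ => Part.mem_some _, rel := fun _ => h' }
  exact BrokenCycle.IsForbidden.mem_collapseClosure (c := c)
    ⟨hw.trans Set.range_const.symm, fun hc => absurd ⟨0, h⟩ hc⟩

/-- Encodes invariance; with `ω` the identity it encodes asymmetry. -/
theorem mem_collapseClosure_of_map (hid : PFun.id X ∈ M) {ω : X →. X} (hω : ω ∈ M) {x y a b : X}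
    (ha : a ∈ ω x) (hb : b ∈ ω y) {P : OrderPair X} (hw : P.weak = {(x, y), (b, a)})
    (hs : P.strict.Nonempty) : P ∈ collapseClosure M D := by
  let c : BrokenCycle M D :=
    { n := 1, ω := ![ω, PFun.id X]
      ω_mem := Fin.forall_fin_two.2 ⟨hω, hid⟩
      x := ![y, a], y := ![x, b], a := ![b, a], b := ![a, b]
      map_x := Fin.forall_fin_two.2 ⟨hb, Part.mem_some _⟩
      map_y := Fin.forall_fin_two.2 ⟨ha, Part.mem_some _⟩
      rel := Fin.forall_fin_two.2 ⟨Relation.ReflTransGen.refl, Relation.ReflTransGen.refl⟩ }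
  refine BrokenCycle.IsForbidden.mem_collapseClosure (c := c) ⟨hw.trans ?_, fun _ => hs⟩
  ext p
  simp [c, Fin.exists_fin_two, eq_comm]

theorem mem_collapseClosure_of_triangle (hid : PFun.id X ∈ M) {x y z : X} {P : OrderPair X}
    (hw : P.weak = {(x, y), (y, z), (z, x)}) (hs : P.strict.Nonempty) :
    P ∈ collapseClosure M D := by
  let c : BrokenCycle M D :=
    { n := 2, ω := fun _ => PFun.id X, ω_mem := fun _ => hid
      x := ![y, z, x], y := ![x, y, z], a := ![y, z, x], b := ![x, y, z]
      map_x := fun _ => Part.mem_some _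
      map_y := fun _ => Part.mem_some _
      rel := fun i => by fin_cases i <;> exact Relation.ReflTransGen.refl }
  refine BrokenCycle.IsForbidden.mem_collapseClosure (c := c) ⟨hw.trans ?_, fun _ => hs⟩
  ext p
  simp [c, Fin.exists_fin_succ, eq_comm]

/-! ### Completeness via maximal consistent order pairs -/

/-- An order pair is consistent if it contains no member of the collapse closure. -/
def Consistent (M : Set (X →. X)) (D Q : OrderPair X) : Prop :=
  ∀ P ∈ collapseClosure M D, ¬ P ≤ Q

/-- Members of the closure are finite, so one below the union of a chain is already below an element
of the chain. -/
theorem Consistent.exists_maximal {Q : OrderPair X} (hQ : Consistent M D Q) :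
    ∃ Q', Q ≤ Q' ∧ Maximal (Consistent M D) Q' := by
  refine zorn_le_nonempty₀ {Q | Consistent M D Q} (fun c hc hchain Q₀ hQ₀ => ?_) Q hQ
  refine ⟨⟨⋃ P ∈ c, P.weak, ⋃ P ∈ c, P.strict,
    Set.iUnion₂_mono fun P _ => P.strict_subset⟩, fun P hP hle => ?_, fun P hP =>
      ⟨Set.subset_biUnion_of_mem (u := OrderPair.weak) hP,
        Set.subset_biUnion_of_mem (u := OrderPair.strict) hP⟩⟩
  have hfin := finite_of_mem_collapseClosure hP
  have key : ∀ (f : OrderPair X → Set (X × X)), Monotone f → ∀ s : Set (X × X), s.Finite →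
      s ⊆ ⋃ P ∈ c, f P → ∃ P ∈ c, s ⊆ f P := by
    intro f hf s hs hsub
    induction s, hs using Set.Finite.induction_on with
    | empty => exact ⟨Q₀, hQ₀, Set.empty_subset _⟩
    | @insert p s _ _ ih =>
      obtain ⟨P, hP, h1⟩ := ih ((Set.subset_insert _ _).trans hsub)
      obtain ⟨P', hP', h2⟩ := Set.mem_iUnion₂.1 (hsub (Set.mem_insert _ _))
      rcases hchain.total hP hP' with h | h
      · exact ⟨P', hP', Set.insert_subset h2 (h1.trans (hf h))⟩
      · exact ⟨P, hP, Set.insert_subset (hf h h2) h1⟩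
  obtain ⟨Q₁, hQ₁, h1⟩ := key OrderPair.weak (fun _ _ h => h.1) _ hfin hle.1
  obtain ⟨Q₂, hQ₂, h2⟩ :=
    key OrderPair.strict (fun _ _ h => h.2) _ (hfin.subset P.strict_subset) hle.2
  rcases hchain.total hQ₁ hQ₂ with h | h
  · exact hc hQ₂ P hP ⟨h1.trans h.1, h2⟩
  · exact hc hQ₁ P hP ⟨h1, h2.trans h.2⟩

theorem mem_weak_or_mem_strict_of_maximal (hid : PFun.id X ∈ M) {Q : OrderPair X}
    (hQ : Maximal (Consistent M D) Q) (x y : X) : (x, y) ∈ Q.weak ∨ (y, x) ∈ Q.strict := by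
  by_contra! hcon
  obtain ⟨hxy, hyx⟩ := hcon
  -- By maximality, `A` obstructs adding `(x, y)` as a weak pair and `B` obstructs adding `(y, x)`
  -- as a strict one. Their collapse cancels both additions and so lies below `Q`.
  obtain ⟨A, hA, hAw, hAs⟩ : ∃ A ∈ collapseClosure M D,
      A.weak ⊆ insert (x, y) Q.weak ∧ A.strict ⊆ Q.strict := by
    by_contra! hcon
    refine hxy ((hQ.2 (y := ⟨insert (x, y) Q.weak, Q.strict,
      Q.strict_subset.trans (Set.subset_insert _ _)⟩) (fun P hP hle => hcon P hP hle.1 hle.2)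
      ⟨Set.subset_insert _ _, subset_rfl⟩).1 (Set.mem_insert _ _))
  obtain ⟨B, hB, hBw, hBs⟩ : ∃ B ∈ collapseClosure M D,
      B.weak ⊆ insert (y, x) Q.weak ∧ B.strict ⊆ insert (y, x) Q.strict := by
    by_contra! hcon
    refine hyx ((hQ.2 (y := ⟨insert (y, x) Q.weak, insert (y, x) Q.strict,
      Set.insert_subset_insert Q.strict_subset⟩) (fun P hP hle => hcon P hP hle.1 hle.2)
      ⟨Set.subset_insert _ _, Set.subset_insert _ _⟩).2 (Set.mem_insert _ _))
  have hpA : (x, y) ∈ A.weak := by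
    by_contra h
    exact hQ.1 A hA ⟨(Set.subset_insert_iff_of_notMem h).1 hAw, hAs⟩
  have hqB : (y, x) ∈ B.weak := by
    by_contra h
    exact hQ.1 B hB ⟨(Set.subset_insert_iff_of_notMem h).1 hBw,
      (Set.subset_insert_iff_of_notMem fun h' => h (B.strict_subset h')).1 hBs⟩
  obtain ⟨E, hE, hEw, hEs⟩ := exists_collapse_mem hid hA hB
    ⟨hpA, fun h => hxy (Q.strict_subset (hAs h))⟩ hqB
  refine hQ.1 E hE (OrderPair.le_def.2 ⟨?_, ?_⟩)
  · rw [hEw]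
    exact Set.union_subset (Set.sdiff_singleton_subset_iff.2 hAw)
      (Set.sdiff_singleton_subset_iff.2 hBw)
  · rw [hEs]
    exact Set.union_subset hAs (Set.sdiff_singleton_subset_iff.2 hBs)

/-- Every consistent order pair is extended by some rationalization. -/
theorem Consistent.exists_rationalization (hid : PFun.id X ∈ M) {Q₀ : OrderPair X}
    (hQ₀ : Consistent M D Q₀) : ∃ R, IsRationalization M D R ∧ Extends R Q₀ := by
  obtain ⟨Q, hle, hQ⟩ := hQ₀.exists_maximal
  have hcomplete := mem_weak_or_mem_strict_of_maximal hid hQ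
  have hid' : ∀ u : X, u ∈ PFun.id X u := fun u => Part.mem_some u
  have hasymm : ∀ {u v : X}, (u, v) ∈ Q.strict → (v, u) ∉ Q.weak := fun {u v} hs hw =>
    hQ.1 ⟨{(u, v), (v, u)}, {(u, v)}, by simp⟩
      (mem_collapseClosure_of_map hid hid (hid' u) (hid' v) rfl (Set.singleton_nonempty _))
      ⟨Set.pair_subset (Q.strict_subset hs) hw, Set.singleton_subset_iff.2 hs⟩
  refine ⟨fun u v => (u, v) ∈ Q.weak, ⟨⟨fun u v => ?_, fun u v w huv hvw => ?_⟩, ?_, ?_, ?_⟩,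
    fun p hp => hle.1 hp, fun p hp => ⟨Q.strict_subset (hle.2 hp), hasymm (hle.2 hp)⟩⟩
  -- A failure of any remaining axiom would, by `hcomplete` or directly, put the pairs of a short
  -- forbidden cycle into `Q`.
  · exact (hcomplete u v).imp_right fun h => Q.strict_subset h
  · refine (hcomplete u w).resolve_right fun hs => ?_
    refine hQ.1 ⟨{(u, v), (v, w), (w, u)}, {(w, u)}, by simp⟩
      (mem_collapseClosure_of_triangle hid rfl (Set.singleton_nonempty _))
      ⟨?_, Set.singleton_subset_iff.2 hs⟩
    exact Set.insert_subset huv (Set.pair_subset hvw (Q.strict_subset hs))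
  · intro ω hω u v a b ha hb
    constructor
    · refine fun huv => (hcomplete a b).resolve_right fun hs => ?_
      exact hQ.1 ⟨{(u, v), (b, a)}, {(b, a)}, by simp⟩
        (mem_collapseClosure_of_map hid hω ha hb rfl (Set.singleton_nonempty _))
        ⟨Set.pair_subset huv (Q.strict_subset hs), Set.singleton_subset_iff.2 hs⟩
    · refine fun hab => (hcomplete u v).resolve_right fun hs => ?_
      exact hQ.1 ⟨{(v, u), (a, b)}, {(v, u)}, by simp⟩
        (mem_collapseClosure_of_map hid hω hb ha rfl (Set.singleton_nonempty _))
        ⟨Set.pair_subset (Q.strict_subset hs) hab, Set.singleton_subset_iff.2 hs⟩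
  · refine fun u v huv => (hcomplete u v).resolve_right fun hs => ?_
    exact hQ.1 ⟨{(v, u)}, {(v, u)}, subset_rfl⟩
      (mem_collapseClosure_of_transWeak hid (Relation.ReflTransGen.single huv) rfl
        (Set.singleton_nonempty _))
      ⟨Set.singleton_subset_iff.2 (Q.strict_subset hs), Set.singleton_subset_iff.2 hs⟩
  · refine fun u v huv => hasymm ((hcomplete v u).resolve_left fun hw => ?_) |> fun h =>
      ⟨(hcomplete u v).resolve_right fun hs => ?_, h⟩
    · exact hQ.1 ⟨{(v, u)}, ∅, Set.empty_subset _⟩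
        (mem_collapseClosure_of_transStrict hid
          ⟨u, v, Relation.ReflTransGen.refl, huv, Relation.ReflTransGen.refl⟩ rfl)
        ⟨Set.singleton_subset_iff.2 hw, Set.empty_subset _⟩
    · exact hQ.1 ⟨{(v, u)}, {(v, u)}, subset_rfl⟩
        (mem_collapseClosure_of_transWeak hid
          (Relation.ReflTransGen.single (D.strict_subset huv)) rfl (Set.singleton_nonempty _))
        ⟨Set.singleton_subset_iff.2 (Q.strict_subset hs), Set.singleton_subset_iff.2 hs⟩

/-- A forbidden weak pair is also forbidden as a strict pair. -/
theorem mem_collapseClosure_strict_of_weak (hid : PFun.id X ∈ M) {u v : X}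
    (h : (⟨{(u, v)}, ∅, Set.empty_subset _⟩ : OrderPair X) ∈ collapseClosure M D) :
    (⟨{(u, v)}, {(u, v)}, Set.Subset.rfl⟩ : OrderPair X) ∈ collapseClosure M D := by
  by_cases huv : u = v
  · subst huv
    exact mem_collapseClosure_of_transWeak hid Relation.ReflTransGen.refl rfl
      (Set.singleton_nonempty _)
  · have hne : (u, v) ≠ (v, u) := fun h => huv (congrArg Prod.fst h)
    -- Collapsing at `(u, v)` and `(v, u)` trades the weak `(u, v)` for the strict one in this
    -- two-cycle.
    have hB : (⟨{(v, u), (u, v)}, {(u, v)}, by simp⟩ : OrderPair X) ∈ collapseClosure M D :=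
      mem_collapseClosure_of_map hid hid (Part.mem_some v) (Part.mem_some u) rfl
        (Set.singleton_nonempty _)
    obtain ⟨E, hE, hw, hs⟩ := exists_collapse_mem hid h hB (x := u) (y := v) (by simp) (by simp)
    have hdiff : ({(u, v)} : Set (X × X)) \ {(v, u)} = {(u, v)} :=
      Set.sdiff_singleton_eq_self hne.symm
    convert hE
    · simp [hw, hdiff]
    · simp [hs, hdiff]

/-- Below a singleton order pair, the collapse closure of strongly acyclic data contains only
order pairs with the same weak part. -/
theorem weak_eq_of_mem_collapseClosure (hD : StronglyAcyclic M D) {P : OrderPair X} {p : X × X}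
    (hP : P ∈ collapseClosure M D) (hle : P.weak ⊆ {p}) : P.weak = {p} := by
  refine (Set.subset_singleton_iff_eq.1 hle).resolve_left fun h0 => hD ?_
  convert hP
  exact OrderPair.ext h0.symm (Set.subset_empty_iff.1 (h0 ▸ P.strict_subset)).symm

end

theorem theorem4 {X : Type*} (M : Set (X →. X)) (hid : PFun.id X ∈ M)
    (hcomp : ∀ ω ∈ M, ∀ ω' ∈ M, PFun.comp ω' ω ∈ M)
    (D : OrderPair X) (hrefl : ∀ x, (x, x) ∈ D.weak) (hD : StronglyAcyclic M D) (x y : X) :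
    ((∀ R : X → X → Prop, IsRationalization M D R → R x y) ↔
      (⟨{(y, x)}, {(y, x)}, Set.Subset.rfl⟩ : OrderPair X) ∈ collapseClosure M D) ∧
    ((∀ R : X → X → Prop, IsRationalization M D R → StrictPart R x y) ↔
      (⟨{(y, x)}, ∅, Set.empty_subset _⟩ : OrderPair X) ∈ collapseClosure M D) := by

  refine ⟨⟨fun h => ?_, fun h R hR => ?_⟩, ⟨fun h => ?_, fun h R hR => ?_⟩⟩
  · by_contra hmem
    obtain ⟨R, hR, -, hs⟩ := Consistent.exists_rationalization (M := M) (D := D) hid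
      (Q₀ := ⟨{(y, x)}, {(y, x)}, Set.Subset.rfl⟩) fun P hP hle => by
        have hw := weak_eq_of_mem_collapseClosure hD hP hle.1
        -- A member below the strict singleton may have empty strict part; it is then upgraded.
        rcases Set.subset_singleton_iff_eq.1 hle.2 with hs | hs
        · refine hmem (mem_collapseClosure_strict_of_weak hid ?_)
          convert hP
          exacts [hw.symm, hs.symm]
        · refine hmem ?_
          convert hP
          exacts [hw.symm, hs.symm]
    exact (hs _ rfl).2 (h R hR)
  · by_contra hxy
    refine not_extends_of_mem_collapseClosure h hR ⟨?_, ?_⟩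
    · rintro _ rfl
      exact (hR.preference.complete x y).resolve_left hxy
    · rintro _ rfl
      exact ⟨(hR.preference.complete x y).resolve_left hxy, hxy⟩
  · by_contra hmem
    obtain ⟨R, hR, hw, -⟩ := Consistent.exists_rationalization (M := M) (D := D) hid
      (Q₀ := ⟨{(y, x)}, ∅, Set.empty_subset _⟩) fun P hP hle => by
        have hw := weak_eq_of_mem_collapseClosure hD hP hle.1
        refine hmem ?_
        convert hP
        exacts [hw.symm, (Set.subset_empty_iff.1 hle.2).symm]
    exact (h R hR).2 (hw _ rfl)
  · have hyx : ¬ R y x := fun hyx => by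
      refine not_extends_of_mem_collapseClosure h hR ⟨?_, ?_⟩
      · rintro _ rfl
        exact hyx
      · rintro _ ⟨⟩
    exact ⟨(hR.preference.complete x y).resolve_right hyx, hyx⟩
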